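/- Let $G=(V,E)$ be a finite acyclic directed graph, multiple channels (edges) between two nodes being allowed, with a source node $s$ and a nonempty set $T\subseteq V\setminus\{s\}$ of sink nodes. Every channel $e$ leads from a node $\mathrm{tail}(e)$ to a node $\mathrm{head}(e)$. For $t\in T$ let $C_t$ be the minimum cut capacity between $s$ and $t$, i.e. the minimum, over all $S\subseteq V$ with $s\in S$ and $t\notin S$, of the number of channels $e$ with $\mathrm{tail}(e)\in S$ and $\mathrm{head}(e)\notin S$. Let $\mathcal F$ be a finite field and let the information rate $w$ be an integer with $1\le w\le C_t$ for all $t\in T$. Add to the network $w$ imaginary channels with head $s$, whose global encoding kernels are the standard unit vectors of $\mathcal F^w$. In random linear network coding, for all pairs $(d,e)$ of a (possibly imaginary) channel $d$ and a channel $e\in E$ with $\mathrm{head}(d)=\mathrm{tail}(e)$, the local encoding coefficients $k_{d,e}$ are independent random variables, each uniformly distributed on $\mathcal F$. The global encoding kernels $f_e\in\mathcal F^w$, $e\in E$, are determined recursively by $$f_e=\sum_{d:\ \mathrm{head}(d)=\mathrm{tail}(e)}k_{d,e}\,f_d .$$ For $t\in T$ let $F_t$ be the matrix whose columns are the kernels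 $f_e$ of the channels $e\in E$ with $\mathrm{head}(e)=t$. Let $$P_{e_t}=\Pr\big(\operatorname{rank}(F_t)<w\big),\qquad P_e=\Pr\big(\exists\, t\in T:\ \operatorname{rank}(F_t)<w\big)$$ be the failure probabilities at the sink node $t$ and for the network $G$. Put $\delta_t=C_t-w$ and $\delta=\min_{t\in T}\delta_t$. Theorem. For every sink node $t\in T$, $$P_{e_t}\ \ge\ \frac1{|\mathcal F|^{\delta_t+1}},\qquad\text{and}\qquad P_e\ \ge\ \frac1{|\mathcal F|^{\delta+1}} .$$ -/

import Mathlib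

open MeasureTheory ProbabilityTheory

/-- A single-source multicast network: a finite acyclic directed multigraph with node set `V` and
channel set `E` (each channel carries one field symbol per unit time), a source node and a nonempty
set of sink nodes, none of which is the source. -/
structure MulticastNetwork (V E : Type*) where
  /-- the node that a channel leaves -/
  tail : E → V
  /-- the node that a channel enters -/
  head : E → V
  /-- the source node `s` -/
  source : V
  /-- the set `T` of sink nodes -/
  sinks : Finset V
  /-- there is no directed cycle -/
  acyclic : ∀ v : V, ¬ Relation.TransGen (fun a b => ∃ e : E, tail e = a ∧ head e = b) v v
  sinks_nonempty : sinks.Nonempty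
  source_notMem_sinks : source ∉ sinks

namespace MulticastNetwork

variable {V E : Type*} (N : MulticastNetwork V E)

/-- The minimum cut capacity `C_t` between the source and the node `t`: the least number of channels
that leave a set of nodes containing the source but not `t`. -/
noncomputable def minCut (t : V) : ℕ :=
  sInf {n : ℕ | ∃ S : Set V, N.source ∈ S ∧ t ∉ S ∧ n = {e : E | N.tail e ∈ S ∧ N.head e ∉ S}.ncard}

/-- `δ_t = C_t - w` (used only for `w ≤ C_t`, where the subtraction does not truncate). -/
noncomputable def excess (w : ℕ) (t : V) : ℕ := N.minCut t - w

/-- `δ`, the minimum of `δ_t` over the sink nodes `t`. -/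
noncomputable def minExcess (w : ℕ) : ℕ := N.sinks.inf' N.sinks_nonempty (N.excess w)

/-- The head of a channel, where `w` imaginary channels `Sum.inl i`, which carry the source symbols
`X_i` and end at the source node, are added to the channels of the network. -/
def extHead (w : ℕ) : Fin w ⊕ E → V := Sum.elim (fun _ => N.source) N.head

/-- The adjacent pairs `(d, e)` of channels: `d`, possibly imaginary, ends where `e` starts. -/
def AdjacentPair (w : ℕ) : Type _ := {p : (Fin w ⊕ E) × E // N.extHead w p.1 = N.tail p.2}

/-- On the channels of an acyclic finite network, the relation "`d` ends where `e` starts" is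
well-founded. -/
theorem wellFounded_adjacent [Finite V] : WellFounded fun d e : E => N.head d = N.tail e := by
  let r : V → V → Prop := fun a b => ∃ e : E, N.tail e = a ∧ N.head e = b
  have hirr : Std.Irrefl (Relation.TransGen r) := ⟨N.acyclic⟩
  have hwf : WellFounded (Relation.TransGen r) := Finite.wellFounded_of_trans_of_irrefl _
  exact Subrelation.wf (fun {d e} h => Relation.TransGen.single ⟨d, rfl, h⟩)
    (InvImage.wf N.tail hwf)

section Coding

variable [Finite V] [Fintype E] {F : Type*} [Field F] {w : ℕ}

open Classical in
/-- The global encoding kernel `f_e` of a channel `e`, a vector over `F` with `w` coordinates,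
determined by the local encoding coefficients `k`: the sum of `k_{d,e} f_d` over all channels `d`
that enter the tail of `e`, where the imaginary channels have the standard unit vectors as kernels. -/
noncomputable def kernel (k : N.AdjacentPair w → F) : E → Fin w → F :=
  N.wellFounded_adjacent.fix fun e f =>
    ∑ d : {d : Fin w ⊕ E // N.extHead w d = N.tail e},
      k ⟨(d.1, e), d.2⟩ •
        (match d with
          | ⟨Sum.inl i, _⟩ => Pi.single i 1
          | ⟨Sum.inr d', h⟩ => f d' h)

open Classical in
/-- The recursion that defines the global encoding kernels. -/
theorem kernel_eq (k : N.AdjacentPair w → F) (e : E) :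
    N.kernel k e = ∑ d : {d : Fin w ⊕ E // N.extHead w d = N.tail e},
      k ⟨(d.1, e), d.2⟩ • Sum.elim (fun i => Pi.single i (1 : F)) (N.kernel k) d.1 := by
  unfold kernel
  rw [WellFounded.fix_eq]
  refine Finset.sum_congr rfl fun d _ => ?_
  rcases d with ⟨i | d', h⟩ <;> rfl

/-- The decoding matrix `F_t`, whose columns are the kernels of the channels that enter `t`. -/
noncomputable def decodingMatrix (k : N.AdjacentPair w → F) (t : V) :
    Matrix (Fin w) {e : E // N.head e = t} F :=
  Matrix.of fun i e => N.kernel k e.1 i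

open Classical in
/-- The sink node `t` cannot decode: the rank of `F_t` is less than `w`. -/
def FailsAt (k : N.AdjacentPair w → F) (t : V) : Prop := (N.decodingMatrix k t).rank < w

/-- Random linear network coding: the local encoding coefficients are independent random variables,
each uniformly distributed on the base field. -/
structure IsRandomCoding [MeasurableSpace F] {Ω : Type*} [MeasurableSpace Ω] (μ : Measure Ω)
    (K : N.AdjacentPair w → Ω → F) : Prop where
  measurable : ∀ p, Measurable (K p)
  independent : iIndepFun K μ
  uniform : ∀ p, μ.map (K p) = uniformOn (Set.univ : Set F)

/-- The failure probability `P_{e_t}` at the node `t`. -/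
noncomputable def sinkFailureProb {Ω : Type*} [MeasurableSpace Ω] (μ : Measure Ω)
    (K : N.AdjacentPair w → Ω → F) (t : V) : ℝ :=
  μ.real {ω | N.FailsAt (fun p => K p ω) t}

/-- The failure probability `P_e` of the network: some sink node cannot decode. -/
noncomputable def failureProb {Ω : Type*} [MeasurableSpace Ω] (μ : Measure Ω)
    (K : N.AdjacentPair w → Ω → F) : ℝ :=
  μ.real {ω | ∃ t ∈ N.sinks, N.FailsAt (fun p => K p ω) t}

end Coding

end MulticastNetwork

namespace MulticastNetwork

/-! Take a minimum cut of `C_t` channels, ordered by depth. The kernels of its `w - 1` shallowest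
channels have a common nonzero orthogonal vector `a`, whatever the coefficients are. The other `δ_t
+ 1` cut channels do not influence `a`. For each of them, taken by increasing depth, `a ⬝ᵥ f_e` is a
linear form in the fresh uniform coefficients of `e`, so it vanishes with conditional probability at
least `1 / |F|` (`card_le_mul_card_orthogonal`). If all vanish, `a` is orthogonal to everything
beyond the cut (`orthogonal_of_cut`), and `t` fails. Probabilities are handled as counts of
coefficient tuples. -/

open Classical in
/-- A finite set `s` has subsets of every size `n ≤ #s` that lie below their complement. -/
theorem exists_initial_subset {ι α : Type*} [LinearOrder α] (ρ : ι → α) (s : Finset ι) :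
    ∀ n ≤ s.card, ∃ B ⊆ s, B.card = n ∧ ∀ b ∈ B, ∀ d ∈ s \ B, ρ b ≤ ρ d := by
  intro n
  induction n with
  | zero => exact fun _ => ⟨∅, by simp, by simp, by simp⟩
  | succ n ih =>
    intro hn
    obtain ⟨B, hBs, hB, hle⟩ := ih (by omega)
    have hne : (s \ B).Nonempty := by
      rw [← Finset.card_pos, Finset.card_sdiff_of_subset hBs]
      omega
    obtain ⟨m, hm, hmin⟩ := Finset.exists_min_image (s \ B) ρ hne
    have hm' := Finset.mem_sdiff.1 hm
    refine ⟨insert m B, Finset.insert_subset hm'.1 hBs, ?_, ?_⟩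
    · rw [Finset.card_insert_of_notMem hm'.2, hB]
    · intro b hb d hd
      simp only [Finset.mem_sdiff, Finset.mem_insert, not_or] at hd
      have hd' : d ∈ s \ B := Finset.mem_sdiff.2 ⟨hd.1, hd.2.2⟩
      rcases Finset.mem_insert.1 hb with rfl | hb
      · exact hmin d hd'
      · exact hle b hb d hd'

/-- Fewer than `w` vectors of `F ^ w` have a common nonzero orthogonal vector. -/
theorem exists_orthogonal {F : Type*} [Field F] {w : ℕ} {ι : Type*} [Fintype ι]
    (h : Fintype.card ι < w) (v : ι → Fin w → F) : ∃ a : Fin w → F, a ≠ 0 ∧ ∀ i, a ⬝ᵥ v i = 0 := by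
  obtain ⟨a, ha, ha0⟩ := Submodule.exists_mem_ne_zero_of_ne_bot
    (LinearMap.ker_ne_bot_of_finrank_lt (f := (Matrix.of v).mulVecLin) (by simpa using h))
  refine ⟨a, ha0, fun i => ?_⟩
  rw [dotProduct_comm]
  exact congrFun (LinearMap.mem_ker.1 ha) i

variable {V E : Type*} (N : MulticastNetwork V E)

instance [Finite E] (w : ℕ) : Finite (N.AdjacentPair w) :=
  inferInstanceAs (Finite {p : (Fin w ⊕ E) × E // N.extHead w p.1 = N.tail p.2})

/-- The minimum cut capacity is attained. -/
theorem exists_minCut {t : V} (ht : t ≠ N.source) :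
    ∃ S : Set V, N.source ∈ S ∧ t ∉ S ∧
      N.minCut t = {e : E | N.tail e ∈ S ∧ N.head e ∉ S}.ncard := by
  refine Nat.sInf_mem (s := {n : ℕ | ∃ S : Set V, N.source ∈ S ∧ t ∉ S ∧
    n = {e : E | N.tail e ∈ S ∧ N.head e ∉ S}.ncard}) ⟨_, {t}ᶜ, ?_, ?_, rfl⟩
  · simpa using ht.symm
  · simp

/-! ### Dependence of kernels on the coefficients, and propagation across a cut -/

variable [Finite V]

/-- The position of a channel in the order induced by adjacency. -/
noncomputable def depth (e : E) : Ordinal :=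
  haveI : IsWellFounded E fun d e => N.head d = N.tail e := ⟨N.wellFounded_adjacent⟩
  IsWellFounded.rank (fun d e : E => N.head d = N.tail e) e

theorem depth_lt {d e : E} (h : N.head d = N.tail e) : N.depth d < N.depth e :=
  haveI : IsWellFounded E fun d e => N.head d = N.tail e := ⟨N.wellFounded_adjacent⟩
  IsWellFounded.rank_lt_of_rel h

variable [Fintype E] {F : Type*} [Field F] {w : ℕ}

/-- The kernels of all channels, the imaginary ones included. -/
noncomputable def extKernel (k : N.AdjacentPair w → F) : Fin w ⊕ E → Fin w → F :=
  Sum.elim (fun i => Pi.single i (1 : F)) (N.kernel k)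

/-- The kernel of a channel does not depend on the coefficients of another channel that is at least
as deep. -/
theorem kernel_congr {k k' : N.AdjacentPair w → F} {e : E}
    (hk : ∀ p, p.1.2 ≠ e → k p = k' p) (e' : E) :
    N.depth e' ≤ N.depth e → e' ≠ e → N.kernel k e' = N.kernel k' e' := by
  induction e' using N.wellFounded_adjacent.induction with
  | _ e' ih =>
    intro hle hne
    rw [kernel_eq, kernel_eq]
    refine Finset.sum_congr rfl fun d _ => ?_
    rw [show k ⟨(d.1, e'), d.2⟩ = k' ⟨(d.1, e'), d.2⟩ from hk _ hne]
    rcases d with ⟨i | d, hd⟩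
    · rfl
    · have hlt := (N.depth_lt hd).trans_le hle
      simp only [Sum.elim_inr]
      rw [ih d hd hlt.le (fun h => hlt.ne (congrArg _ h))]

/-- Channels entering the tail of `e` are strictly shallower than `e`, and imaginary kernels are
constant. -/
theorem extKernel_congr {k k' : N.AdjacentPair w → F} {e : E}
    (hk : ∀ p, p.1.2 ≠ e → k p = k' p) {d : Fin w ⊕ E} (hd : N.extHead w d = N.tail e) :
    N.extKernel k d = N.extKernel k' d := by
  rcases d with i | d
  · rfl
  · have hlt := N.depth_lt hd
    exact N.kernel_congr hk d hlt.le (fun h => hlt.ne (congrArg _ h))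

open Classical in
theorem dotProduct_kernel (k : N.AdjacentPair w → F) (a : Fin w → F) (e : E) :
    a ⬝ᵥ N.kernel k e = ∑ d : {d : Fin w ⊕ E // N.extHead w d = N.tail e},
      k ⟨(d.1, e), d.2⟩ * (a ⬝ᵥ N.extKernel k d.1) := by
  rw [kernel_eq, dotProduct_sum]
  simp only [dotProduct_smul, smul_eq_mul]
  rfl

/-- A vector orthogonal to the kernels of all channels of a cut is orthogonal to the kernels of all
channels that end beyond the cut. -/
theorem orthogonal_of_cut {k : N.AdjacentPair w → F} {S : Set V} (hS : N.source ∈ S)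
    {a : Fin w → F} (ha : ∀ e, N.tail e ∈ S → N.head e ∉ S → a ⬝ᵥ N.kernel k e = 0) (e : E) :
    N.head e ∉ S → a ⬝ᵥ N.kernel k e = 0 := by
  induction e using N.wellFounded_adjacent.induction with
  | _ e ih =>
    intro he
    by_cases ht : N.tail e ∈ S
    · exact ha e ht he
    -- All channels entering this tail end outside `S`; none is imaginary, since the source lies in
    -- `S`.
    rw [dotProduct_kernel]
    refine Finset.sum_eq_zero fun d _ => ?_
    rcases d with ⟨i | d, hd⟩
    · exact absurd (show N.tail e ∈ S from hd ▸ hS) ht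
    · have hd' : N.head d = N.tail e := hd
      simp only [extKernel, Sum.elim_inr]
      rw [ih d hd' (hd' ▸ ht), mul_zero]

/-- The node `t` fails if a nonzero vector is orthogonal to the kernels of all its channels. -/
theorem failsAt_of_orthogonal {k : N.AdjacentPair w → F} {t : V} {a : Fin w → F} (ha0 : a ≠ 0)
    (ha : ∀ e, N.head e = t → a ⬝ᵥ N.kernel k e = 0) : N.FailsAt k t := by
  classical
  unfold FailsAt
  by_contra hcon
  have hr : (N.decodingMatrix k t).rank = w := le_antisymm
    ((Matrix.rank_le_card_height _).trans_eq (Fintype.card_fin w)) (not_lt.1 hcon)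
  -- Rank `w` would make the `w` rows independent, yet `a` gives a vanishing combination of them.
  have hli : LinearIndependent F (N.decodingMatrix k t).row := by
    rw [linearIndependent_iff_card_eq_finrank_span, Set.finrank, ← Matrix.rank_eq_finrank_span_row, hr,
      Fintype.card_fin]
  refine ha0 (Matrix.vecMul_injective_iff.2 hli ?_)
  refine Eq.trans ?_ (Matrix.zero_vecMul _).symm
  ext e
  exact ha e.1 e.2

/-! ### Counting coefficient tuples -/

section Counting

variable [Fintype F]

open Classical in
/-- Given any event that does not depend on the coefficients of the channel `e`, the kernel of `e` is
orthogonal to a vector that does not depend on them either with probability at least `1 / |F|`. -/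
theorem card_le_mul_card_orthogonal [Fintype (N.AdjacentPair w → F)] (e : E)
    (P : (N.AdjacentPair w → F) → Prop) (a : (N.AdjacentPair w → F) → Fin w → F)
    (hP : ∀ k k', (∀ p, p.1.2 ≠ e → k p = k' p) → P k → P k')
    (ha : ∀ k k', (∀ p, p.1.2 ≠ e → k p = k' p) → a k = a k') :
    (Finset.univ.filter P).card ≤
      Fintype.card F * (Finset.univ.filter fun k => P k ∧ a k ⬝ᵥ N.kernel k e = 0).card := by
  let D := {d : Fin w ⊕ E // N.extHead w d = N.tail e}
  let Q (k : N.AdjacentPair w → F) (d : D) : Prop := a k ⬝ᵥ N.extKernel k d.1 ≠ 0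
  -- The bound comes from a surjection `T` that overwrites one coefficient of `e` with nonzero
  -- factor `a ⬝ᵥ f_d`. The choice of `d` sees only `Q`, which ignores the coefficients of `e`, so
  -- it is the same before and after overwriting.
  let sel (q : D → Prop) : Option D := if h : ∃ d, q d then some h.choose else none
  let T (x : F × (N.AdjacentPair w → F)) : N.AdjacentPair w → F :=
    (sel (Q x.2)).elim x.2 fun d => Function.update x.2 ⟨(d.1, e), d.2⟩ x.1
  have hQ : ∀ k k', (∀ p, p.1.2 ≠ e → k p = k' p) → Q k = Q k' := by
    intro k k' h
    funext d
    simp only [Q]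
    rw [ha k k' h, N.extKernel_congr h d.2]
  rw [← Finset.card_univ, ← Finset.card_product]
  refine Finset.card_le_card_of_surjOn T fun k hk => ?_
  have hPk : P k := by simpa using hk
  by_cases h : ∃ d, Q k d
  · let d₀ := h.choose
    have hd₀ : a k ⬝ᵥ N.extKernel k d₀.1 ≠ 0 := h.choose_spec
    let p₀ : N.AdjacentPair w := ⟨(d₀.1, e), d₀.2⟩
    -- The value of this coefficient that makes `a ⬝ᵥ f_e` zero.
    let c := k p₀ - (a k ⬝ᵥ N.kernel k e) / (a k ⬝ᵥ N.extKernel k d₀.1)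
    let g := Function.update k p₀ c
    have hg : ∀ p : N.AdjacentPair w, p.1.2 ≠ e → k p = g p := by
      intro p hp
      refine (Function.update_of_ne ?_ _ _).symm
      rintro rfl
      exact hp rfl
    have hsel : sel (Q g) = some d₀ := by
      rw [← hQ k g hg]
      exact dif_pos h
    refine ⟨(k p₀, g), ?_, ?_⟩
    · simp only [Finset.coe_product, Set.mem_prod, Finset.coe_univ, Set.mem_univ, true_and,
        Finset.coe_filter, Finset.mem_univ, Set.mem_ofPred_eq]
      refine ⟨hP k g hg hPk, ?_⟩
      have hdiff : a k ⬝ᵥ N.kernel g e - a k ⬝ᵥ N.kernel k e =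
          (c - k p₀) * (a k ⬝ᵥ N.extKernel k d₀.1) := by
        rw [dotProduct_kernel, dotProduct_kernel, ← Finset.sum_sub_distrib,
          Finset.sum_eq_single d₀]
        · rw [← N.extKernel_congr hg d₀.2, ← sub_mul]
          congr 2
          exact Function.update_self _ _ _
        · intro d _ hd
          rw [← N.extKernel_congr hg d.2, ← sub_mul]
          have : g ⟨(d.1, e), d.2⟩ = k ⟨(d.1, e), d.2⟩ := by
            refine Function.update_of_ne (fun hEq => hd (Subtype.ext ?_)) _ _
            exact congrArg (fun p : N.AdjacentPair w => p.1.1) hEq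
          rw [this, sub_self, zero_mul]
        · simp
      rw [← ha k g hg]
      have hc : c - k p₀ = -((a k ⬝ᵥ N.kernel k e) / (a k ⬝ᵥ N.extKernel k d₀.1)) := by
        simp [c]
      rw [hc, neg_mul, div_mul_cancel₀ _ hd₀] at hdiff
      linear_combination hdiff
    · simp only [T, hsel, Option.elim_some]
      exact (Function.update_idem _ _ _).trans (Function.update_eq_self _ _)
  -- The linear form is identically zero, so `k` is its own preimage; the field component is
  -- arbitrary.
  · refine ⟨(0, k), ?_, ?_⟩
    · simp only [Finset.coe_product, Set.mem_prod, Finset.coe_univ, Set.mem_univ, true_and,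
        Finset.coe_filter, Finset.mem_univ, Set.mem_ofPred_eq]
      refine ⟨hPk, ?_⟩
      rw [dotProduct_kernel]
      refine Finset.sum_eq_zero fun d _ => ?_
      rw [not_not.1 (not_exists.1 h d), mul_zero]
    · have hsel : sel (Q k) = none := dif_neg h
      simp only [T, hsel, Option.elim_none]

open Classical in
/-- A vector that does not depend on the coefficients of the channels of `D` is orthogonal to their
kernels with probability at least `1 / |F| ^ |D|`. -/
theorem card_le_pow_mul_card_orthogonal [Fintype (N.AdjacentPair w → F)]
    (a : (N.AdjacentPair w → F) → Fin w → F) (D : Finset E) :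
    (∀ e ∈ D, ∀ k k', (∀ p, p.1.2 ≠ e → k p = k' p) → a k = a k') →
    Fintype.card (N.AdjacentPair w → F) ≤ Fintype.card F ^ D.card *
      (Finset.univ.filter fun k => ∀ e ∈ D, a k ⬝ᵥ N.kernel k e = 0).card := by
  -- Adding a deepest channel last keeps the event for the others independent of its coefficients;
  -- ties in depth are harmless.
  induction D using Finset.induction_on_max_value N.depth with
  | empty => simp
  | insert e D he hmax ih =>
    intro ha
    have hae := ha e (Finset.mem_insert_self e D)
    refine (ih fun e' he' => ha e' (Finset.mem_insert_of_mem he')).trans ?_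
    rw [Finset.card_insert_of_notMem he, pow_succ, mul_assoc]
    have hstep := N.card_le_mul_card_orthogonal e
      (fun k => ∀ e ∈ D, a k ⬝ᵥ N.kernel k e = 0) a (fun k k' h hk e' he' => ?_) hae
    · refine Nat.mul_le_mul_left _ (le_trans (le_of_eq ?_) (hstep.trans_eq ?_))
      · congr
      · congr 2
        ext k
        simp [and_comm]
    · rw [← hae k k' h, ← N.kernel_congr h e' (hmax e' he') (ne_of_mem_of_not_mem he' he)]
      exact hk e' he'

open Classical in
/-- The proportion of the local encoding coefficients for which the node `t` fails. -/
theorem card_le_pow_mul_card_failsAt [Fintype (N.AdjacentPair w → F)] (hw : 1 ≤ w) {t : V}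
    (ht : t ≠ N.source) (hC : w ≤ N.minCut t) :
    Fintype.card (N.AdjacentPair w → F) ≤ Fintype.card F ^ (N.excess w t + 1) *
      (Finset.univ.filter fun k : N.AdjacentPair w → F => N.FailsAt k t).card := by
  obtain ⟨S, hsS, htS, hcut⟩ := N.exists_minCut ht
  let cut : Finset E := Finset.univ.filter fun e => N.tail e ∈ S ∧ N.head e ∉ S
  have hcard : N.minCut t = cut.card := by
    rw [hcut, ← Set.ncard_coe_finset]
    simp [cut]
  -- `w - 1` is the largest size that forces an orthogonal vector; it leaves `C_t - (w - 1) = δ_t +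
  -- 1` channels.
  obtain ⟨B, hBs, hB, hle⟩ := exists_initial_subset N.depth cut (w - 1) (by omega)
  have hBw : Fintype.card B < w := by
    rw [Fintype.card_coe]
    omega
  -- The vector is a function of the kernels on `B` alone, so it inherits their independence of the
  -- deeper coefficients.
  choose A hA0 hA using exists_orthogonal (F := F) hBw
  have hD : (cut \ B).card = N.excess w t + 1 := by
    rw [Finset.card_sdiff_of_subset hBs, hB, excess]
    omega
  rw [← hD]
  refine (N.card_le_pow_mul_card_orthogonal (F := F)
    (fun k => A fun e : B => N.kernel k e) (cut \ B) ?_).trans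
    (Nat.mul_le_mul_left _ (Finset.card_le_card fun k hk => ?_))
  · intro e he k k' h
    congr 1
    funext b
    exact N.kernel_congr h b (hle b b.2 e he)
      (ne_of_mem_of_not_mem b.2 (Finset.mem_sdiff.1 he).2)
  · simp only [Finset.mem_filter, Finset.mem_univ, true_and] at hk ⊢
    refine N.failsAt_of_orthogonal (hA0 fun e : B => N.kernel k e) fun e he =>
      N.orthogonal_of_cut hsS (fun e h1 h2 => ?_) e (he ▸ htS)
    by_cases heB : e ∈ B
    · exact hA (fun e : B => N.kernel k e) ⟨e, heB⟩
    · exact hk e (Finset.mem_sdiff.2 ⟨by simp [cut, h1, h2], heB⟩)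

end Counting

end MulticastNetwork

/-! ### From counts to probabilities -/

open Classical in
/-- A finite family of independent uniform variables on a finite set is uniform on the product. -/
theorem measureReal_iIndepFun_uniform {ι F : Type*} [Fintype ι] [Fintype F] [Nonempty F]
    [MeasurableSpace F] [MeasurableSingletonClass F] {Ω : Type*} [MeasurableSpace Ω]
    (μ : Measure Ω) [IsProbabilityMeasure μ] (K : ι → Ω → F) (hm : ∀ p, Measurable (K p))
    (hi : iIndepFun K μ) (hu : ∀ p, μ.map (K p) = uniformOn (Set.univ : Set F))
    (P : (ι → F) → Prop) :
    μ.real {ω | P fun p => K p ω} =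
      (Finset.univ.filter P).card / (Fintype.card (ι → F) : ℝ) := by
  have hmap : μ.map (fun ω p => K p ω) = Measure.pi fun _ : ι => uniformOn (Set.univ : Set F) := by
    rw [(iIndepFun_iff_map_fun_eq_pi_map fun p => (hm p).aemeasurable).1 hi]
    simp only [hu]
  have hset : {ω | P fun p => K p ω} = (fun ω p => K p ω) ⁻¹' (Finset.univ.filter P : Finset _) := by
    ext ω
    simp
  rw [hset, ← map_measureReal_apply (measurable_pi_lambda _ hm) (Finset.measurableSet _), hmap,
    ← sum_measureReal_singleton]
  have hsing : ∀ k : ι → F, (Measure.pi fun _ : ι => uniformOn (Set.univ : Set F)).real {k} =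
      1 / (Fintype.card (ι → F) : ℝ) := by
    intro k
    rw [measureReal_def, Measure.pi_singleton]
    simp [uniformOn_univ, Fintype.card_pi]
  simp [hsing, div_eq_mul_inv]

namespace MulticastNetwork

/-- The failure probability at a node is at least `1 / |F| ^ (δ_t + 1)`. -/
theorem le_sinkFailureProb {V E : Type*} [Finite V] [Fintype E] (N : MulticastNetwork V E)
    {F : Type*} [Field F] [Fintype F] [MeasurableSpace F] [MeasurableSingletonClass F]
    {w : ℕ} (hw : 1 ≤ w) {t : V} (ht : t ≠ N.source) (hC : w ≤ N.minCut t)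
    {Ω : Type*} [MeasurableSpace Ω] (μ : Measure Ω) [IsProbabilityMeasure μ]
    (K : N.AdjacentPair w → Ω → F) (hK : N.IsRandomCoding μ K) :
    1 / (Fintype.card F : ℝ) ^ (N.excess w t + 1) ≤ N.sinkFailureProb μ K t := by
  classical
  have := Fintype.ofFinite (N.AdjacentPair w)
  rw [sinkFailureProb, measureReal_iIndepFun_uniform μ K hK.measurable hK.independent hK.uniform
    (fun k => N.FailsAt k t), div_le_div_iff₀ (by positivity) (by positivity), one_mul, mul_comm]
  exact_mod_cast N.card_le_pow_mul_card_failsAt (F := F) hw ht hC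

end MulticastNetwork

theorem mainTheorem5 {V E : Type*} [Finite V] [Fintype E] (N : MulticastNetwork V E)
    {F : Type*} [Field F] [Fintype F] [MeasurableSpace F] [MeasurableSingletonClass F]
    {w : ℕ} (hw : 1 ≤ w) (hwC : ∀ t ∈ N.sinks, w ≤ N.minCut t)
    {Ω : Type*} [MeasurableSpace Ω] (μ : Measure Ω) [IsProbabilityMeasure μ]
    (K : N.AdjacentPair w → Ω → F) (hK : N.IsRandomCoding μ K) :
    (∀ t ∈ N.sinks,
      N.sinkFailureProb μ K t ≥ 1 / (Fintype.card F : ℝ) ^ (N.excess w t + 1)) ∧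
    N.failureProb μ K ≥ 1 / (Fintype.card F : ℝ) ^ (N.minExcess w + 1) := by
  have hne : ∀ t ∈ N.sinks, t ≠ N.source := fun t ht =>
    ne_of_mem_of_not_mem ht N.source_notMem_sinks
  have hsink : ∀ t ∈ N.sinks,
      N.sinkFailureProb μ K t ≥ 1 / (Fintype.card F : ℝ) ^ (N.excess w t + 1) := fun t ht =>
    N.le_sinkFailureProb hw (hne t ht) (hwC t ht) μ K hK
  refine ⟨hsink, ?_⟩
  -- Failure at a sink attaining `δ` already gives the network bound.
  obtain ⟨t, ht, hmin⟩ := Finset.exists_mem_eq_inf' N.sinks_nonempty (N.excess w)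
  rw [MulticastNetwork.minExcess, hmin]
  exact (hsink t ht).trans (measureReal_mono fun ω hω => ⟨t, ht, hω⟩)
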